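/- For a positive integer $n$ let $S_n$ be the set of permutations of $\{1,\dots,n\}$, with the distance $d_\infty(f,g)=\max_{1\le i\le n}|f(i)-g(i)|$. An $(n,M,d)$ limited-magnitude rank-modulation code (LMRM code) is a subset $C\subseteq S_n$ with exactly $M$ elements such that $d_\infty(f,g)\ge d$ for all distinct $f,g\in C$; its rate is $R=\frac{\log_2 M}{n}$. **Theorem.** For every constant $0<\delta\le 1$ there is an infinite sequence of nonempty $(n,M_n,d_n)$-LMRM codes, one for each length $n\ge 1$, such that $\frac{d_n}{n}\ge\delta$ for every $n$ and whose rates $R_n=\frac{\log_2 M_n}{n}$ satisfy $$R_n\ \ge\ f_{\mathrm{GV}}(\delta)+o(1)\qquad(n\to\infty),$$ where $$f_{\mathrm{GV}}(\delta)=\begin{cases}\log_2\frac1\delta+2\delta(\log_2 e-1)-1, & 0<\delta\le\frac12,\\[2pt] -2\delta\log_2\frac1\delta+2(1-\delta)\log_2 e, & \frac12\le\delta\le 1\end{cases}$$ (the two expressions agree at $\delta=\frac12$). -/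

import Mathlib

open Filter Topology

/-- The distance `d_∞(f, g) = max_i |f(i) - g(i)|` on the symmetric group `S_n`, realised as the
permutations of `Fin n = {0, …, n-1}` (relabelling `{1, …, n}` does not change differences). -/
def linfDist {n : ℕ} (f g : Equiv.Perm (Fin n)) : ℕ :=
  Finset.univ.sup fun i : Fin n => (((f i : ℕ) : ℤ) - ((g i : ℕ) : ℤ)).natAbs

/-- `C ⊆ S_n` is a limited-magnitude rank-modulation code with parameters `(n, M, d)`. -/
def IsLMRMCode (n M d : ℕ) (C : Finset (Equiv.Perm (Fin n))) : Prop :=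
  C.card = M ∧ ∀ f ∈ C, ∀ g ∈ C, f ≠ g → d ≤ linfDist f g

/-- The rate `R = log₂ M / n` of an `(n, M, d)` code. -/
noncomputable def lmrmRate (n M : ℕ) : ℝ :=
  Real.logb 2 (M : ℝ) / (n : ℝ)

/-- The function `f_GV`, meaningful on `(0, 1]`; the two formulas agree at `δ = 1/2`. -/
noncomputable def fGV (δ : ℝ) : ℝ :=
  if δ ≤ 1 / 2 then
    Real.logb 2 (1 / δ) + 2 * δ * (Real.logb 2 (Real.exp 1) - 1) - 1
  else
    -2 * δ * Real.logb 2 (1 / δ) + 2 * (1 - δ) * Real.logb 2 (Real.exp 1)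

/-- The second formula for `f_GV` is valid on all of `[1/2, ∞)`, including the common endpoint. -/
theorem fGV_of_half_le {δ : ℝ} (h : 1 / 2 ≤ δ) :
    fGV δ = -2 * δ * Real.logb 2 (1 / δ) + 2 * (1 - δ) * Real.logb 2 (Real.exp 1) := by
  unfold fGV
  split_ifs with h'
  · obtain rfl : δ = 1 / 2 := le_antisymm h' h
    have h2 : Real.logb 2 (1 / (1 / 2 : ℝ)) = 1 := by
      rw [one_div_one_div]
      exact Real.logb_self_eq_one (by norm_num)
    rw [h2]
    ring
  · rfl

/-!
The codes come from the Gilbert–Varshamov argument: a code of maximal size with minimum distance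
`d = ⌈δ n⌉` has balls of radius `r = d - 1` covering `S_n`, so its size is at least `n!` divided by
the size of a ball (`exists_code_factorial_le`).

The size of a ball is the permanent of a band matrix, for which the bound `∏ j, w j / e`, up to a
factor `exp (o n)`, is needed, where `w j` is the number of points of `{0, …, n - 1}` at distance at
most `r` from `j`. Instead of Bregman's inequality, a coarse-graining gives this directly. Cut
`{0, …, n - 1}` into blocks of length `N = ⌊√n⌋ + 1`. For `f` in the ball around `g`, the block of
`f i` is one of the at most `w (g i) / N + 2` blocks meeting the window around `g i`, and the
permutations with a given block pattern number at most the product of the factorials of the block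
sizes (`card_linfDist_ball_le`). Since `N! ≈ (N / e) ^ N`, the product of the two counts is
`∏ j, (w j + O(N)) / e` up to a factor `exp (O(N log N))` (`log_ball_bound_le`,
`succ_mul_card_blockWindow_le`).

Finally `w j / n` is close to `windowWidth δ (j / n)`, which is bounded below by `δ` and Lipschitz,
so that the logarithm of the product is a Riemann sum (`sum_log_windowWidth_le`), and the integral
of `log (windowWidth δ x)` over `[0, 1]` is `-fGV δ * log 2` (`integral_log_windowWidth_eq`). All
error terms are `O(√n log n)`.
-/

/-! ### Counting permutations with a prescribed block pattern -/

open Nat in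
/-- Two permutations with the same pattern `p ∘ f` differ by one that preserves `p`. -/
theorem card_perm_comp_eq_le {α ι : Type*} [Fintype α] [DecidableEq α] [Fintype ι] [DecidableEq ι]
    (p c : α → ι) :
    (Finset.univ.filter fun f : Equiv.Perm α => p ∘ f = c).card ≤
      ∏ b, (Fintype.card {a // p a = b})! := by
  rcases (Finset.univ.filter fun f : Equiv.Perm α => p ∘ f = c).eq_empty_or_nonempty with
    h | ⟨f₀, h₀⟩
  · simp [h]
  rw [← DomMulAct.stabilizer_card p, Fintype.card_subtype]
  refine Finset.card_le_card_of_injOn (fun f => f * f₀⁻¹) ?_ ?_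
  · intro f hf
    simp only [Finset.coe_filter, Finset.mem_univ, true_and, Set.mem_ofPred_eq,
      Finset.mem_filter] at hf h₀ ⊢
    funext a
    have h1 := congrFun hf (f₀⁻¹ a)
    have h2 := congrFun h₀ (f₀⁻¹ a)
    simp only [Function.comp_apply, Equiv.Perm.coe_inv, Equiv.apply_symm_apply] at h1 h2
    simp [h1, h2]
  · intro f _ g _ h
    exact mul_right_cancel h

open Nat in
/-- There are at most `∏ a, (W a).card` admissible patterns `p ∘ f`, each attained by at most
`∏ b, (card p⁻¹(b))!` permutations. -/
theorem card_perm_comp_mem_le {α ι : Type*} [Fintype α] [DecidableEq α] [Fintype ι]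
    [DecidableEq ι] (p : α → ι) (W : α → Finset ι) :
    (Finset.univ.filter fun f : Equiv.Perm α => ∀ a, p (f a) ∈ W a).card ≤
      (∏ b, (Fintype.card {a // p a = b})!) * ∏ a, (W a).card := by
  rw [← Fintype.card_piFinset]
  refine Finset.card_le_mul_card_image_of_maps_to (f := fun f : Equiv.Perm α => p ∘ f) ?_ _ ?_
  · intro f hf
    simpa using hf
  · intro c _
    refine le_trans (Finset.card_le_card ?_) (card_perm_comp_eq_le p c)
    exact Finset.filter_subset_filter _ (Finset.subset_univ _)

/-! ### Balls for the maximum distance -/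

theorem linfDist_comm {n : ℕ} (f g : Equiv.Perm (Fin n)) : linfDist f g = linfDist g f := by
  unfold linfDist
  congr 1
  funext i
  omega

theorem linfDist_lt_iff {n d : ℕ} (hd : 0 < d) (f g : Equiv.Perm (Fin n)) :
    linfDist f g < d ↔ ∀ i, (((f i : ℕ) : ℤ) - ((g i : ℕ) : ℤ)).natAbs < d := by
  unfold linfDist
  rw [Finset.sup_lt_iff (by simpa using hd)]
  simp

/-- The Gilbert–Varshamov argument: the balls around a code of maximal size cover `S_n`. -/
theorem exists_code_factorial_le (n d B : ℕ) (hd : 0 < d)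
    (hB : ∀ g : Equiv.Perm (Fin n), (Finset.univ.filter fun f => linfDist f g < d).card ≤ B) :
    ∃ C : Finset (Equiv.Perm (Fin n)), IsLMRMCode n C.card d C ∧ n.factorial ≤ C.card * B := by
  classical
  obtain ⟨C, hC, hmax⟩ := Finset.exists_max_image
    (Finset.univ.filter fun C : Finset (Equiv.Perm (Fin n)) => IsLMRMCode n C.card d C)
    Finset.card ⟨∅, by simp [IsLMRMCode]⟩
  simp only [Finset.mem_filter, Finset.mem_univ, true_and] at hC hmax
  refine ⟨C, hC, ?_⟩
  -- A permutation outside all balls could be added to `C`.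
  have hcover : (Finset.univ : Finset (Equiv.Perm (Fin n))) ⊆
      C.biUnion fun g => Finset.univ.filter fun f => linfDist f g < d := by
    intro f _
    by_contra hf
    simp only [Finset.mem_biUnion, Finset.mem_filter, Finset.mem_univ, true_and, not_exists,
      not_and, not_lt] at hf
    have hfC : f ∉ C := fun h => by
      have h0 : linfDist f f = 0 := by simp [linfDist]
      have := hf f h
      omega
    have hins := hmax (insert f C) ⟨rfl, by
      intro x hx y hy hxy
      rw [Finset.mem_insert] at hx hy
      rcases hx with rfl | hx <;> rcases hy with rfl | hy
      · exact absurd rfl hxy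
      · exact hf y hy
      · rw [linfDist_comm]
        exact hf x hx
      · exact hC.2 x hx y hy hxy⟩
    rw [Finset.card_insert_of_notMem hfC] at hins
    omega
  calc n.factorial = (Finset.univ : Finset (Equiv.Perm (Fin n))).card := by
        rw [Finset.card_univ, Fintype.card_perm, Fintype.card_fin]
    _ ≤ _ := Finset.card_le_card hcover
    _ ≤ _ := Finset.card_biUnion_le_card_mul _ _ _ fun g _ => hB g

/-- The index of the block of length `N` containing `j`. -/
def blockIndex (n N : ℕ) (j : Fin n) : Fin (n / N + 1) :=
  ⟨j / N, Nat.lt_succ_of_le (Nat.div_le_div_right j.2.le)⟩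

/-- The blocks of length `N` that meet the window of radius `r` around `j` in `{0, …, n - 1}`. -/
def blockWindow (n N r : ℕ) (j : Fin n) : Finset (Fin (n / N + 1)) :=
  Finset.univ.filter fun b => (j - r) / N ≤ (b : ℕ) ∧ (b : ℕ) ≤ min (j + r) (n - 1) / N

theorem blockWindow_nonempty (n N r : ℕ) (j : Fin n) : (blockWindow n N r j).Nonempty := by
  refine ⟨blockIndex n N j, ?_⟩
  simp only [blockWindow, blockIndex, Finset.mem_filter, Finset.mem_univ, true_and]
  exact ⟨Nat.div_le_div_right (by omega), Nat.div_le_div_right (by omega)⟩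

theorem card_blockWindow_le (n N r : ℕ) (j : Fin n) :
    (blockWindow n N r j).card ≤ min (j + r) (n - 1) / N + 1 - (j - r) / N := by
  rw [← Nat.card_Icc]
  refine Finset.card_le_card_of_injOn (fun b => (b : ℕ)) ?_ Fin.val_injective.injOn
  intro b hb
  simpa [blockWindow] using hb

theorem card_blockIndex_fiber_le (n N : ℕ) (hN : 0 < N) (b : Fin (n / N + 1)) :
    Fintype.card {j // blockIndex n N j = b} ≤ N := by
  have : Fintype.card {j // blockIndex n N j = b} ≤ (Finset.Ico (b * N) (b * N + N)).card := by
    rw [Fintype.card_subtype]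
    refine Finset.card_le_card_of_injOn (fun j => (j : ℕ)) ?_ Fin.val_injective.injOn
    intro j hj
    simp only [Finset.coe_filter, Finset.mem_univ, true_and, Set.mem_ofPred_eq, blockIndex,
      Fin.ext_iff] at hj
    simp only [Finset.coe_Ico, Set.mem_Ico]
    rw [← hj]
    exact ⟨Nat.div_mul_le_self _ _, Nat.lt_div_mul_add hN⟩
  simpa using this

open Nat in
/-- The bound does not depend on the centre `g`: the window of `f i` is the one around `g i`, and
`i ↦ g i` only permutes the factors. -/
theorem card_linfDist_ball_le (n N r : ℕ) (g : Equiv.Perm (Fin n)) :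
    (Finset.univ.filter fun f => linfDist f g < r + 1).card ≤
      (∏ b, (Fintype.card {j // blockIndex n N j = b})!) * ∏ j, (blockWindow n N r j).card := by
  rw [← Equiv.prod_comp g fun j => (blockWindow n N r j).card]
  refine le_trans (Finset.card_le_card ?_) (card_perm_comp_mem_le (blockIndex n N) _)
  intro f hf
  simp only [Finset.mem_filter, Finset.mem_univ, true_and, linfDist_lt_iff r.succ_pos] at hf ⊢
  intro i
  have h := hf i
  have h1 := (f i).2
  simp only [blockWindow, blockIndex, Finset.mem_filter, Finset.mem_univ, true_and]
  exact ⟨Nat.div_le_div_right (by omega), Nat.div_le_div_right (by omega)⟩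

/-! ### Logarithmic estimates -/

theorem log_factorial_le (m : ℕ) :
    Real.log (m.factorial : ℝ) ≤ (m + 1) * Real.log (m + 1) - m := by
  induction m with
  | zero => simp
  | succ m ih =>
    have h1 : (0 : ℝ) < m + 1 := by positivity
    have h2 : (0 : ℝ) < m + 2 := by positivity
    -- The step is `(m + 2) log ((m + 2) / (m + 1)) ≥ 1`, from `log x ≥ 1 - 1 / x`.
    have h := Real.one_sub_inv_le_log_of_pos (div_pos h2 h1)
    rw [Real.log_div h2.ne' h1.ne', inv_div] at h
    have h3 : (1 : ℝ) ≤ (m + 2) * (Real.log (m + 2) - Real.log (m + 1)) := by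
      calc (1 : ℝ) = (m + 2) * (1 - (m + 1) / (m + 2)) := by field_simp; ring
        _ ≤ _ := by gcongr
    rw [Nat.factorial_succ, Nat.cast_mul, Real.log_mul (by positivity) (by positivity)]
    push_cast
    rw [show (m : ℝ) + 1 + 1 = m + 2 by ring]
    nlinarith

theorem le_log_factorial (n : ℕ) :
    n * Real.log n - n ≤ Real.log (n.factorial : ℝ) := by
  rcases Nat.eq_zero_or_pos n with rfl | hn
  · simp
  have hn' : (0 : ℝ) < n := by exact_mod_cast hn
  have h := Real.log_le_log (by positivity) (Real.pow_div_factorial_le_exp _ hn'.le n)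
  rw [Real.log_div (by positivity) (by positivity), Real.log_pow, Real.log_exp] at h
  linarith

/-- Each block of size `m ≤ N` has `log m! ≤ (m + 1) log (N + 1) - m`. The block sizes add up to
`n`, so the resulting `n log (N + 1)` is distributed as one factor `N + 1` to each of the `n`
windows, where it turns a number of blocks into a number of points. -/
theorem log_ball_bound_le (n N r : ℕ) (hN : 0 < N) :
    Real.log (((∏ b, (Fintype.card {j // blockIndex n N j = b}).factorial) *
      ∏ j, (blockWindow n N r j).card : ℕ) : ℝ) ≤
      (n / N + 1 : ℕ) * Real.log (N + 1) - n +
        ∑ j : Fin n, Real.log ((N + 1) * ((blockWindow n N r j).card : ℝ)) := by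
  have hpos : ∀ j : Fin n, ((blockWindow n N r j).card : ℝ) ≠ 0 := fun j => by
    exact_mod_cast (Finset.card_pos.2 (blockWindow_nonempty n N r j)).ne'
  have hL : 0 ≤ Real.log ((N : ℝ) + 1) := Real.log_nonneg (by linarith [Nat.cast_nonneg (α := ℝ) N])
  have hsum : ∑ b, (Fintype.card {j // blockIndex n N j = b} : ℝ) = n := by
    rw [← Nat.cast_sum]
    simp_rw [Fintype.card_subtype]
    rw [← Finset.card_eq_sum_card_fiberwise (fun _ _ => Finset.mem_coe.2 (Finset.mem_univ _))]
    simp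
  have hfac : ∀ b, Real.log ((Fintype.card {j // blockIndex n N j = b}).factorial : ℝ) ≤
      Real.log (N + 1) + (Real.log (N + 1) - 1) * Fintype.card {j // blockIndex n N j = b} := by
    intro b
    set m := Fintype.card {j // blockIndex n N j = b}
    have hm : (m : ℝ) ≤ N := by exact_mod_cast card_blockIndex_fiber_le n N hN b
    have h1 : Real.log ((m : ℝ) + 1) ≤ Real.log (N + 1) :=
      Real.log_le_log (by positivity) (by linarith)
    have h2 := mul_le_mul_of_nonneg_left h1 (by positivity : (0 : ℝ) ≤ m + 1)
    linarith [log_factorial_le m]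
  rw [Nat.cast_mul, Nat.cast_prod, Nat.cast_prod, Real.log_mul
    (Finset.prod_ne_zero_iff.2 fun b _ => by positivity)
    (Finset.prod_ne_zero_iff.2 fun j _ => hpos j), Real.log_prod (fun b _ => by positivity),
    Real.log_prod (fun j _ => hpos j)]
  have h1 := Finset.sum_le_sum fun b (_ : b ∈ Finset.univ) => hfac b
  rw [Finset.sum_add_distrib, ← Finset.mul_sum, hsum] at h1
  have h2 : ∑ j : Fin n, Real.log ((N + 1) * ((blockWindow n N r j).card : ℝ)) =
      n * Real.log (N + 1) + ∑ j : Fin n, Real.log ((blockWindow n N r j).card : ℝ) := by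
    rw [Finset.sum_congr rfl fun j _ => Real.log_mul (by positivity) (hpos j),
      Finset.sum_add_distrib]
    simp
  simp only [Finset.sum_const, Finset.card_univ, Fintype.card_fin, nsmul_eq_mul] at h1
  rw [h2]
  linarith

/-! ### The limiting window width -/

/-- The length of `[x - δ, x + δ] ∩ [0, 1]`, for `x ∈ [0, 1]` and `0 ≤ δ`. -/
noncomputable def windowWidth (δ x : ℝ) : ℝ := min 1 (x + δ) - max 0 (x - δ)

theorem le_windowWidth {δ x : ℝ} (hδ1 : δ ≤ 1) (hx0 : 0 ≤ x) (hx1 : x ≤ 1) (hδ0 : 0 ≤ δ) :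
    δ ≤ windowWidth δ x := by
  unfold windowWidth
  rcases min_cases 1 (x + δ) with h | h <;> rcases max_cases 0 (x - δ) with h' | h' <;> linarith

theorem windowWidth_le_add {δ x y : ℝ} : windowWidth δ x ≤ windowWidth δ y + 2 * |y - x| := by
  unfold windowWidth
  have h := neg_abs_le (y - x)
  have h2 := le_abs_self (y - x)
  rcases min_cases 1 (x + δ) with h | h <;> rcases max_cases 0 (x - δ) with h' | h' <;>
  rcases min_cases 1 (y + δ) with h | h <;> rcases max_cases 0 (y - δ) with h' | h' <;> linarith

theorem continuous_windowWidth (δ : ℝ) : Continuous (windowWidth δ) := by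
  unfold windowWidth
  fun_prop

theorem log_le_log_add_div {a b t δ : ℝ} (hδ : 0 < δ) (ha : 0 < a) (hb : δ ≤ b) (ht : 0 ≤ t)
    (h : a ≤ b + t) : Real.log a ≤ Real.log b + t / δ := by
  have hb' : 0 < b := hδ.trans_le hb
  calc Real.log a ≤ Real.log (b * (1 + t / b)) := by
        refine Real.log_le_log ha (h.trans_eq ?_)
        field_simp
    _ = Real.log b + Real.log (1 + t / b) := Real.log_mul hb'.ne' (by positivity)
    _ ≤ Real.log b + t / b := by
        have := Real.log_le_sub_one_of_pos (show 0 < 1 + t / b by positivity)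
        linarith
    _ ≤ _ := by gcongr

theorem intervalIntegrable_log_windowWidth {δ a b : ℝ} (hδ0 : 0 < δ) (hδ1 : δ ≤ 1)
    (ha : 0 ≤ a) (hab : a ≤ b) (hb : b ≤ 1) :
    IntervalIntegrable (fun x => Real.log (windowWidth δ x)) MeasureTheory.volume a b := by
  refine ContinuousOn.intervalIntegrable ?_
  rw [Set.uIcc_of_le hab]
  exact (continuous_windowWidth δ).continuousOn.log fun x hx =>
    (hδ0.trans_le (le_windowWidth hδ1 (ha.trans hx.1) (hx.2.trans hb) hδ0.le)).ne'

theorem integral_log_windowWidth_eq {δ : ℝ} (hδ0 : 0 < δ) (hδ1 : δ ≤ 1) :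
    ∫ x in (0 : ℝ)..1, Real.log (windowWidth δ x) = -(fGV δ * Real.log 2) := by
  -- The width is `x + δ` on `[0, a]`, constant on `[a, 1 - a]` and `1 - x + δ` on `[1 - a, 1]`.
  obtain ⟨a, ha⟩ : ∃ a, a = min δ (1 - δ) := ⟨_, rfl⟩
  have ha0 : 0 ≤ a := ha ▸ le_min hδ0.le (by linarith)
  have haδ : a ≤ δ := ha ▸ min_le_left _ _
  have haδ' : a ≤ 1 - δ := ha ▸ min_le_right _ _
  have ha1 : a ≤ 1 - a := by linarith
  have hcase : a = δ ∨ a = 1 - δ := by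
    rcases min_cases δ (1 - δ) with h | h <;> simp [ha, h.1]
  have i1 : ∫ x in (0 : ℝ)..a, Real.log (windowWidth δ x) = ∫ x in δ..(a + δ), Real.log x := by
    have := intervalIntegral.integral_comp_add_right (a := 0) (b := a) Real.log δ
    rw [zero_add] at this
    rw [← this]
    refine intervalIntegral.integral_congr fun x hx => ?_
    rw [Set.uIcc_of_le ha0] at hx
    simp only [windowWidth]
    rw [min_eq_right (by linarith [hx.2]), max_eq_left (by linarith [hx.2]), sub_zero]
  have i2 : ∫ x in a..(1 - a), Real.log (windowWidth δ x) = (1 - 2 * a) * Real.log (a + δ) := by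
    rw [intervalIntegral.integral_congr (g := fun _ => Real.log (a + δ)),
      intervalIntegral.integral_const, smul_eq_mul]
    · ring
    intro x hx
    rw [Set.uIcc_of_le ha1] at hx
    simp only [windowWidth]
    congr 1
    rcases hcase with h | h
    · rw [min_eq_right (by linarith [hx.2]), max_eq_right (by linarith [hx.1]), h]
      ring
    · rw [min_eq_left (by linarith [hx.1]), max_eq_left (by linarith [hx.2]), h]
      ring
  have i3 : ∫ x in (1 - a)..1, Real.log (windowWidth δ x) = ∫ x in δ..(a + δ), Real.log x := by
    have := intervalIntegral.integral_comp_sub_left (a := 1 - a) (b := 1) Real.log (1 + δ)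
    rw [show 1 + δ - 1 = δ by ring, show 1 + δ - (1 - a) = a + δ by ring] at this
    rw [← this]
    refine intervalIntegral.integral_congr fun x hx => ?_
    rw [Set.uIcc_of_le (by linarith)] at hx
    simp only [windowWidth]
    rw [min_eq_left (by linarith [hx.1]), max_eq_right (by linarith [hx.1])]
    congr 1
    ring
  rw [← intervalIntegral.integral_add_adjacent_intervals (b := a)
      (intervalIntegrable_log_windowWidth hδ0 hδ1 le_rfl ha0 (by linarith))
      (intervalIntegrable_log_windowWidth hδ0 hδ1 ha0 (by linarith) le_rfl),
    ← intervalIntegral.integral_add_adjacent_intervals (a := a) (b := 1 - a)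
      (intervalIntegrable_log_windowWidth hδ0 hδ1 ha0 ha1 (by linarith))
      (intervalIntegrable_log_windowWidth hδ0 hδ1 (by linarith) (by linarith) le_rfl),
    i1, i2, i3, integral_log]
  have hl2 : Real.log 2 ≠ 0 := (Real.log_pos one_lt_two).ne'
  rcases le_total δ (1 / 2) with h | h
  · have h2 : a = δ := ha.trans (min_eq_left (by linarith))
    rw [h2, fGV, if_pos h, ← two_mul, Real.log_mul two_ne_zero hδ0.ne', Real.logb, Real.logb,
      Real.log_exp, one_div, Real.log_inv]
    field_simp
    ring
  · have h2 : a = 1 - δ := ha.trans (min_eq_right (by linarith))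
    rw [h2, fGV_of_half_le h, sub_add_cancel, Real.log_one, Real.logb, Real.logb,
      Real.log_exp, one_div, Real.log_inv]
    field_simp
    ring

/-- A Riemann sum of the Lipschitz function `log ∘ windowWidth δ` exceeds its integral by
`O(1 / n)`. -/
theorem sum_log_windowWidth_le {δ : ℝ} (hδ0 : 0 < δ) (hδ1 : δ ≤ 1) {n : ℕ} (hn : 0 < n) :
    ∑ j : Fin n, Real.log (windowWidth δ ((j : ℕ) / n)) ≤
      n * (∫ x in (0 : ℝ)..1, Real.log (windowWidth δ x)) + 2 / δ := by
  have hn' : (0 : ℝ) < n := by exact_mod_cast hn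
  have hstep : ∀ j < n, (j : ℝ) / n ≤ ((j + 1 : ℕ) : ℝ) / n ∧ ((j + 1 : ℕ) : ℝ) / n ≤ 1 := by
    intro j hj
    refine ⟨by gcongr; simp, (div_le_one hn').2 (by exact_mod_cast hj)⟩
  have hint : ∀ j < n, IntervalIntegrable (fun x => Real.log (windowWidth δ x))
      MeasureTheory.volume ((j : ℝ) / n) (((j + 1 : ℕ) : ℝ) / n) := fun j hj =>
    intervalIntegrable_log_windowWidth hδ0 hδ1 (by positivity) (hstep j hj).1 (hstep j hj).2
  have hsum := intervalIntegral.sum_integral_adjacent_intervals (a := fun j : ℕ => (j : ℝ) / n) hint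
  simp only [Nat.cast_zero, zero_div, div_self hn'.ne'] at hsum
  have hterm : ∀ j ∈ Finset.range n, Real.log (windowWidth δ ((j : ℝ) / n)) ≤
      n * (∫ x in ((j : ℝ) / n)..(((j + 1 : ℕ) : ℝ) / n), Real.log (windowWidth δ x)) +
        2 / n / δ := by
    intro j hj
    rw [Finset.mem_range] at hj
    obtain ⟨h1, h2⟩ := hstep j hj
    have hj0 : 0 ≤ (j : ℝ) / n := by positivity
    have hlen : ((j + 1 : ℕ) : ℝ) / n - (j : ℝ) / n = 1 / n := by
      push_cast
      ring
    have hmono := intervalIntegral.integral_mono_on h1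
      (intervalIntegrable_const (c := Real.log (windowWidth δ ((j : ℝ) / n)) - 2 / n / δ))
      (hint j hj) (fun x hx => by
        have hx1 : |x - (j : ℝ) / n| ≤ 1 / n := by
          rw [abs_of_nonneg (by linarith [hx.1])]
          linarith [hx.2]
        have := log_le_log_add_div (a := windowWidth δ ((j : ℝ) / n)) (b := windowWidth δ x)
          (t := 2 / n) hδ0
          (hδ0.trans_le (le_windowWidth hδ1 hj0 (h1.trans h2) hδ0.le))
          (le_windowWidth hδ1 (hj0.trans hx.1) (hx.2.trans h2) hδ0.le) (by positivity)
          (windowWidth_le_add.trans (by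
            rw [show (2 : ℝ) / n = 2 * (1 / n) by ring]
            gcongr))
        linarith)
    rw [intervalIntegral.integral_const, hlen, smul_eq_mul] at hmono
    have := mul_le_mul_of_nonneg_left hmono hn'.le
    rw [← mul_assoc, mul_one_div_cancel hn'.ne', one_mul] at this
    linarith
  rw [Fin.sum_univ_eq_sum_range (fun j => Real.log (windowWidth δ ((j : ℝ) / n))), ← hsum,
    Finset.mul_sum]
  refine (Finset.sum_le_sum hterm).trans_eq ?_
  rw [Finset.sum_add_distrib, Finset.sum_const, Finset.card_range, nsmul_eq_mul]
  congr 1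
  field_simp

/-! ### The asymptotic size of a ball -/

/-- Up to `O(N)`, the blocks meeting a window cover as many points as the window itself. The
condition `n < N * N` makes the last, lower-order summand `n / N` of the left side `O(N)` too. -/
theorem succ_mul_card_blockWindow_le {δ : ℝ} {n N r : ℕ} (hn : 0 < n) (hnN : n < N * N)
    (hr : (r : ℝ) ≤ δ * n) (j : Fin n) :
    ((N : ℝ) + 1) * ((blockWindow n N r j).card : ℝ) ≤
      n * (windowWidth δ ((j : ℕ) / n) + 4 * N / n) := by
  have hN : 0 < N := Nat.pos_of_ne_zero (by rintro rfl; simp at hnN)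
  have hn' : (0 : ℝ) < n := by exact_mod_cast hn
  have hj := j.2
  obtain ⟨A, hA⟩ : ∃ A, A = (j : ℕ) - r := ⟨_, rfl⟩
  obtain ⟨B, hB⟩ : ∃ B, B = min ((j : ℕ) + r) (n - 1) := ⟨_, rfl⟩
  have hs := card_blockWindow_le n N r j
  rw [← hA, ← hB] at hs
  have hs' : (blockWindow n N r j).card ≤ N := by
    have h1 : B / N < N := Nat.div_lt_of_lt_mul (by omega)
    exact (hs.trans (Nat.sub_le _ _)).trans h1
  have key : (N + 1) * (blockWindow n N r j).card + A ≤ B + 4 * N := by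
    have h0 := Nat.div_le_div_right (c := N) (show A ≤ B by omega)
    have h1 := Nat.div_mul_le_self B N
    have h2 := Nat.lt_div_mul_add hN (a := A)
    have h3 : (blockWindow n N r j).card + A / N ≤ B / N + 1 := by omega
    have h4 := Nat.mul_le_mul_right N h3
    linarith [add_mul (blockWindow n N r j).card (A / N) N, add_mul (B / N) 1 N]
  have keyR : ((N : ℝ) + 1) * ((blockWindow n N r j).card : ℝ) + A ≤ B + 4 * N := by
    exact_mod_cast key
  have hB' : (B : ℝ) ≤ n * min 1 ((j : ℕ) / n + δ) := by
    rw [mul_min_of_nonneg _ _ hn'.le, mul_add, mul_div_cancel₀ _ hn'.ne', mul_one]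
    refine le_min (by exact_mod_cast (show B ≤ n by omega)) ?_
    have : (B : ℝ) ≤ (j : ℕ) + r := by exact_mod_cast (show B ≤ j + r by omega)
    linarith
  have hA' : n * max 0 ((j : ℕ) / n - δ) ≤ (A : ℝ) := by
    rw [mul_max_of_nonneg _ _ hn'.le, mul_sub, mul_div_cancel₀ _ hn'.ne', mul_zero]
    refine max_le (by positivity) ?_
    have : ((j : ℕ) : ℝ) ≤ A + r := by exact_mod_cast (show (j : ℕ) ≤ A + r by omega)
    linarith
  rw [windowWidth, mul_add, mul_sub, mul_div_cancel₀ _ hn'.ne']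
  linarith

theorem log_ball_bound_le_integral {δ : ℝ} (hδ0 : 0 < δ) (hδ1 : δ ≤ 1) {n N r : ℕ} (hn : 0 < n)
    (hnN : n < N * N) (hr : (r : ℝ) ≤ δ * n) :
    Real.log (((∏ b, (Fintype.card {j // blockIndex n N j = b}).factorial) *
      ∏ j, (blockWindow n N r j).card : ℕ) : ℝ) ≤
      n * Real.log n - n - n * (fGV δ * Real.log 2) + (N * Real.log (N + 1) + (4 * N + 2) / δ) := by
  have hN : 0 < N := Nat.pos_of_ne_zero (by rintro rfl; simp at hnN)
  have hn' : (0 : ℝ) < n := by exact_mod_cast hn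
  have hL : 0 ≤ Real.log ((N : ℝ) + 1) := Real.log_nonneg (by linarith [Nat.cast_nonneg (α := ℝ) N])
  have hk : ((n / N + 1 : ℕ) : ℝ) * Real.log (N + 1) ≤ N * Real.log (N + 1) := by
    gcongr
    exact Nat.div_lt_of_lt_mul hnN
  have hj : ∀ j : Fin n, Real.log ((N + 1) * ((blockWindow n N r j).card : ℝ)) ≤
      Real.log n + (Real.log (windowWidth δ ((j : ℕ) / n)) + 4 * N / n / δ) := by
    intro j
    have hc : (0 : ℝ) < (blockWindow n N r j).card := by
      exact_mod_cast Finset.card_pos.2 (blockWindow_nonempty n N r j)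
    have hw := le_windowWidth (x := (j : ℕ) / n) hδ1 (by positivity)
      ((div_le_one hn').2 (by exact_mod_cast j.2.le)) hδ0.le
    have hpos : 0 < windowWidth δ ((j : ℕ) / n) + 4 * N / n := by
      have : 0 ≤ 4 * (N : ℝ) / n := by positivity
      linarith
    calc _ ≤ Real.log (n * (windowWidth δ ((j : ℕ) / n) + 4 * N / n)) :=
          Real.log_le_log (by positivity) (succ_mul_card_blockWindow_le hn hnN hr j)
      _ = Real.log n + Real.log (windowWidth δ ((j : ℕ) / n) + 4 * N / n) :=
          Real.log_mul hn'.ne' hpos.ne'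
      _ ≤ _ := by
        gcongr
        exact log_le_log_add_div hδ0 hpos hw (by positivity) le_rfl
  have hsum := Finset.sum_le_sum fun j (_ : j ∈ Finset.univ) => hj j
  rw [Finset.sum_add_distrib, Finset.sum_add_distrib] at hsum
  simp only [Finset.sum_const, Finset.card_univ, Fintype.card_fin, nsmul_eq_mul] at hsum
  have hR := sum_log_windowWidth_le hδ0 hδ1 hn
  rw [integral_log_windowWidth_eq hδ0 hδ1] at hR
  have h4 : (n : ℝ) * (4 * N / n / δ) + 2 / δ = (4 * N + 2) / δ := by
    field_simp
  linarith [log_ball_bound_le n N r hN]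

/-- The error term, as a function of `m = ⌊√n⌋`, that comes from blocks of length `m + 1`. -/
noncomputable def rateError (δ : ℝ) (m : ℕ) : ℝ :=
  ((m + 1) * Real.log (m + 2) + (4 * (m + 1) + 2) / δ) / (m ^ 2 * Real.log 2)

theorem tendsto_rateError (δ : ℝ) : Tendsto (rateError δ) atTop (𝓝 0) := by
  have hinv : Tendsto (fun m : ℕ => ((m : ℝ))⁻¹) atTop (𝓝 0) := tendsto_inv_atTop_nhds_zero_nat
  have hlog : Tendsto (fun m : ℕ => Real.log ((m : ℝ) + 2) / m) atTop (𝓝 0) := by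
    have h1 : Tendsto (fun m : ℕ => Real.log ((m : ℝ) + 2) / ((m : ℝ) + 2)) atTop (𝓝 0) := by
      have := (Real.isLittleO_log_id_atTop.tendsto_div_nhds_zero).comp
        (tendsto_atTop_add_const_right _ (2 : ℝ) tendsto_natCast_atTop_atTop)
      exact this
    have h2 : Tendsto (fun m : ℕ => 1 + 2 * ((m : ℝ))⁻¹) atTop (𝓝 (1 + 2 * 0)) :=
      tendsto_const_nhds.add (hinv.const_mul 2)
    have h3 := h1.mul h2
    rw [zero_mul] at h3
    refine h3.congr' ?_
    filter_upwards [eventually_gt_atTop 0] with m hm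
    have : (0 : ℝ) < m := by exact_mod_cast hm
    field_simp
  have h : Tendsto (fun m : ℕ => ((1 + (m : ℝ)⁻¹) * (Real.log ((m : ℝ) + 2) / m) +
      (4 * (m : ℝ)⁻¹ + 6 * ((m : ℝ)⁻¹ * (m : ℝ)⁻¹)) / δ) / Real.log 2) atTop
      (𝓝 (((1 + 0) * 0 + (4 * 0 + 6 * (0 * 0)) / δ) / Real.log 2)) :=
    (((tendsto_const_nhds.add hinv).mul hlog).add
      (((hinv.const_mul 4).add ((hinv.mul hinv).const_mul 6)).div_const δ)).div_const _
  simp only [mul_zero, add_zero, zero_div] at h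
  refine h.congr' ?_
  filter_upwards [eventually_gt_atTop 0] with m hm
  have : (0 : ℝ) < m := by exact_mod_cast hm
  unfold rateError
  rcases eq_or_ne δ 0 with rfl | hδ
  · simp only [div_zero, add_zero]
    field_simp
  field_simp
  ring

theorem tendsto_nat_sqrt_atTop : Tendsto Nat.sqrt atTop atTop :=
  tendsto_atTop_mono' _ (Eventually.of_forall fun _ => le_rfl)
    (tendsto_atTop_atTop.2 fun b => ⟨b * b, fun _ ha => Nat.le_sqrt.2 ha⟩)

/-! ### Codes attaining the Gilbert–Varshamov rate -/

theorem exists_code_rate_ge {δ : ℝ} (hδ0 : 0 < δ) (hδ1 : δ ≤ 1) {n : ℕ} (hn : 0 < n) :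
    ∃ C : Finset (Equiv.Perm (Fin n)), IsLMRMCode n C.card ⌈δ * n⌉₊ C ∧ 1 ≤ C.card ∧
      fGV δ + -rateError δ n.sqrt ≤ lmrmRate n C.card := by
  have hn' : (0 : ℝ) < n := by exact_mod_cast hn
  have hl2 : 0 < Real.log 2 := Real.log_pos one_lt_two
  -- Balls of radius `r = d - 1 < δ n` suffice to cover.
  obtain ⟨r, hr⟩ : ∃ r, ⌈δ * n⌉₊ = r + 1 :=
    Nat.exists_eq_succ_of_ne_zero (Nat.ceil_pos.2 (by positivity)).ne'
  have hrδ : (r : ℝ) ≤ δ * n := (Nat.lt_ceil.1 (by omega)).le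
  have hnN := Nat.lt_succ_sqrt n
  obtain ⟨C, hC, hcard⟩ := exists_code_factorial_le n (r + 1) _ r.succ_pos
    (card_linfDist_ball_le n (n.sqrt + 1) r)
  have hlogB := log_ball_bound_le_integral hδ0 hδ1 hn hnN hrδ
  set B := (∏ b, (Fintype.card {j // blockIndex n (n.sqrt + 1) j = b}).factorial) *
    ∏ j, (blockWindow n (n.sqrt + 1) r j).card
  have hCB : C.card * B ≠ 0 := (n.factorial_pos.trans_le hcard).ne'
  have hC0 : C.card ≠ 0 := left_ne_zero_of_mul hCB
  have hB0 : B ≠ 0 := right_ne_zero_of_mul hCB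
  refine ⟨C, hr ▸ hC, Nat.one_le_iff_ne_zero.2 hC0, ?_⟩
  have hlog : Real.log (n.factorial : ℝ) ≤ Real.log C.card + Real.log B := by
    rw [← Real.log_mul (by exact_mod_cast hC0) (by exact_mod_cast hB0)]
    exact Real.log_le_log (by positivity) (by exact_mod_cast hcard)
  have hm : (1 : ℝ) ≤ n.sqrt := by exact_mod_cast Nat.sqrt_pos.2 hn
  obtain ⟨E, hE⟩ : ∃ E : ℝ, E = ((n.sqrt : ℝ) + 1) * Real.log (n.sqrt + 2) +
    (4 * ((n.sqrt : ℝ) + 1) + 2) / δ := ⟨_, rfl⟩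
  have hE0 : 0 ≤ E := by
    have : 0 ≤ Real.log ((n.sqrt : ℝ) + 2) := Real.log_nonneg (by linarith)
    rw [hE]
    positivity
  have hmain : n * (fGV δ * Real.log 2) - E ≤ Real.log C.card := by
    push_cast at hlogB
    rw [show (n.sqrt : ℝ) + 1 + 1 = n.sqrt + 2 by ring] at hlogB
    linarith [le_log_factorial n]
  have herr : E / (n * Real.log 2) ≤ rateError δ n.sqrt := by
    rw [rateError, ← hE]
    gcongr
    exact_mod_cast Nat.sqrt_le' n
  calc fGV δ + -rateError δ n.sqrt ≤ fGV δ - E / (n * Real.log 2) := by linarith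
    _ = (n * (fGV δ * Real.log 2) - E) / (n * Real.log 2) := by field_simp
    _ ≤ Real.log C.card / (n * Real.log 2) := by gcongr
    _ = lmrmRate n C.card := by
      rw [lmrmRate, Real.logb]
      field_simp

theorem mainTheorem10 (δ : ℝ) (hδ0 : 0 < δ) (hδ1 : δ ≤ 1) :
    ∃ (M d : ℕ → ℕ) (C : ∀ n : ℕ, Finset (Equiv.Perm (Fin n))) (ε : ℕ → ℝ),
      Tendsto ε atTop (𝓝 0) ∧
      ∀ n : ℕ, 1 ≤ n →
        IsLMRMCode n (M n) (d n) (C n) ∧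
        1 ≤ M n ∧
        δ ≤ (d n : ℝ) / (n : ℝ) ∧
        fGV δ + ε n ≤ lmrmRate n (M n) := by
  have h : ∀ n : ℕ, ∃ C : Finset (Equiv.Perm (Fin n)), 1 ≤ n →
      IsLMRMCode n C.card ⌈δ * n⌉₊ C ∧ 1 ≤ C.card ∧
        fGV δ + -rateError δ n.sqrt ≤ lmrmRate n C.card := by
    intro n
    by_cases hn : 1 ≤ n
    · obtain ⟨C, hC⟩ := exists_code_rate_ge hδ0 hδ1 hn
      exact ⟨C, fun _ => hC⟩
    · exact ⟨∅, fun h => absurd h hn⟩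
  choose C hC using h
  refine ⟨fun n => (C n).card, fun n => ⌈δ * n⌉₊, C, fun n => -rateError δ n.sqrt, ?_, ?_⟩
  · simpa using ((tendsto_rateError δ).comp tendsto_nat_sqrt_atTop).neg
  · intro n hn
    obtain ⟨h1, h2, h3⟩ := hC n hn
    exact ⟨h1, h2, (le_div_iff₀ (by exact_mod_cast hn)).2 (Nat.le_ceil _), h3⟩
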